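/- Let $p$ be a prime, $n\ge 3$ and $N\ge 0$ integers, and let $u_0,\dots,u_n\in\mathbb Q_p$ satisfy the SOMOS-4 recurrence $u_{k+4}=\dfrac{u_{k+1}u_{k+3}+u_{k+2}^2}{u_k}$ for $0\le k\le n-4$, with $u_0,u_1,u_2,u_3\in\mathbb Z_p^\times$. Suppose that none of $u_0,\dots,u_n$ is divisible by $p^N$, i.e. lies in $p^N\mathbb Z_p$. Let $a,b,c,d$ be approximations of $u_0,u_1,u_2,u_3$ modulo $p^N$. For $m\in\{1,2\}$ consider the following algorithm. Start with the variables $a,b,c,d$ and $\mathrm{prec}=N$; throughout, the variables are approximate numbers, known modulo $p^{\mathrm{prec}}$. Then repeat $n-3$ times: 1. read off $\alpha=v_p(a)$ and $\beta=v_p(bd+c^2)$ from the approximations (possible if $a$ and $bd+c^2$ are nonzero modulo $p^{\mathrm{prec}}$; otherwise the algorithm is stuck); 2. choose arbitrary representatives $a',b',c',d'$ of $a,b,c,d$ modulo $p^{\mathrm{prec}}$ (for $b',c',d'$ only the digits up to precision $O(p^{\mathrm{prec}+\beta-(m-1)\alpha})$ matter); 3. replace $\mathrm{prec}$ by $\mathrm{prec}+\beta-m\alpha$;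 4. replace $(a,b,c,d)$ by $\bigl(b',c',d',\tfrac{b'd'+c'^2}{a'}\bigr)$, all known modulo $p^{\mathrm{prec}}$ for the new value of $\mathrm{prec}$ (represented by arbitrary elements of their classes). Finally return $d+O(p^N)$. Then, for $m=1$ and for $m=2$: all of $u_0,\dots,u_n$ lie in $\mathbb Z_p$; whatever choices are made, the algorithm never gets stuck, and it returns $u_n$ correctly modulo $p^N$. Moreover, let $f(a,b,c,d)=\bigl(b,c,d,\tfrac{bd+c^2}{a}\bigr)$, let $f_i$ be the $i$-th iterate of $f$, let $D(a,b,c,d)$ be the Jacobian matrix of $f$ and let $D_i=D(u_{i-1},u_i,u_{i+1},u_{i+2})\cdots D(u_0,u_1,u_2,u_3)$. For $0\le i\le n-3$, the map $f_i$ is differentiable at $(u_0,u_1,u_2,u_3)$ with differential $\varphi_i$ given by $D_i$, and after $i$ iterations of the loop $$(a,b,c,d)\equiv(u_i,u_{i+1},u_{i+2},u_{i+3})\pmod{p^N\varphi_i(\mathbb Z_p^4)},$$ while $\mathrm{prec}=N+v_p(\det D_i)$ if $m=2$, and $\mathrm{prec}=N+v_p(\det D_i)+\sum_{j<i}v_p(u_j)$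 if $m=1$. -/

import Mathlib

/-- `x ≡ y mod p ^ k` in `ℚ_p`, i.e. `x - y ∈ p ^ k ℤ_p`: the two numbers have the same
approximation `x + O(p ^ k)`. -/
def PadicCongr {p : ℕ} [Fact p.Prime] (k : ℤ) (x y : ℚ_[p]) : Prop :=
  ∃ z : ℤ_[p], x - y = (p : ℚ_[p]) ^ k * (z : ℚ_[p])

/-- The state of the main loop: the variables `a, b, c, d`, each of which stands for the
approximate number `a + O(p ^ prec)`, ..., and the working precision `prec`. -/
structure SomosState (p : ℕ) [Fact p.Prime] where
  a : ℚ_[p]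
  b : ℚ_[p]
  c : ℚ_[p]
  d : ℚ_[p]
  prec : ℤ

/-- The values of the four variables, as a vector. -/
def SomosState.vec {p : ℕ} [Fact p.Prime] (s : SomosState p) : Fin 4 → ℚ_[p] :=
  ![s.a, s.b, s.c, s.d]

/-- One iteration of the loop, leading from the state `s` to the state `t`:
`prec ← prec + v_p(b d + c ^ 2) - m v_p(a)`, where the parameter `m` is the number of times that
`v_p(a)` is subtracted.

* `m = 1`: `prec ← prec + v_p(b d + c ^ 2)`; lift to precision `O(p ^ prec)`;
  `prec ← prec - v_p(a)`.
* `m = 2`: `prec ← prec + v_p(b d + c ^ 2) - v_p(a)`; lift to precision `O(p ^ prec)`;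
  `prec ← prec - v_p(a)`. The total change is the valuation `v_p((b d + c ^ 2) / a ^ 2)` of the
  Jacobian determinant.

The valuations of `a` and of `b d + c ^ 2` have to be read off from the approximations at
precision `O(p ^ prec)`; this is possible only if these numbers are nonzero modulo `p ^ prec`, and
the loop is stuck otherwise (first two clauses).

The lift is nondeterministic: `a', b', c', d'` are any numbers with the given approximations
(`a' = s.a` being one of the choices). Modulo `p ^ t.prec`, the quotient `(b' d' + c' ^ 2) / a'`
depends on `b', c', d'` only modulo `p ^ (t.prec + v_p(a))`, the precision of the lift. The new
variables are any representatives of `b' + O(p ^ t.prec)`, `c' + O(p ^ t.prec)`,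
`d' + O(p ^ t.prec)` and `e + O(p ^ t.prec)`, where `e = (b' d' + c' ^ 2) / a'`. -/
def SomosState.Step {p : ℕ} [Fact p.Prime] (m : ℕ) (s t : SomosState p) : Prop :=
  ¬ PadicCongr s.prec s.a 0 ∧
  ¬ PadicCongr s.prec (s.b * s.d + s.c ^ 2) 0 ∧
  t.prec = s.prec + (s.b * s.d + s.c ^ 2).valuation - (m : ℤ) * s.a.valuation ∧
  ∃ a' b' c' d' : ℚ_[p],
    (PadicCongr s.prec a' s.a ∧ PadicCongr s.prec b' s.b ∧
      PadicCongr s.prec c' s.c ∧ PadicCongr s.prec d' s.d) ∧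
    (PadicCongr t.prec t.a b' ∧ PadicCongr t.prec t.b c' ∧
      PadicCongr t.prec t.c d' ∧ PadicCongr t.prec t.d ((b' * d' + c' ^ 2) / a'))

/-- `SomosReach m a b c d N i s`: some execution (with parameter `m`) on the input `a, b, c, d`,
known at precision `O(p ^ N)`, is in the state `s` after `i` iterations of the loop. -/
inductive SomosReach {p : ℕ} [Fact p.Prime] (m : ℕ) (a b c d : ℚ_[p]) (N : ℕ) :
    ℕ → SomosState p → Prop
  | init : SomosReach m a b c d N 0 ⟨a, b, c, d, (N : ℤ)⟩
  | step {i : ℕ} {s t : SomosState p} :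
      SomosReach m a b c d N i s → s.Step m t → SomosReach m a b c d N (i + 1) t

/-- Some execution of the algorithm (with parameter `m`) on the input `(a, b, c, d, n, N)`
completes the `n - 3` iterations of the loop and returns `d + O(p ^ N)`, represented by `r`. -/
def SomosReturns {p : ℕ} [Fact p.Prime] (m : ℕ) (a b c d : ℚ_[p]) (n N : ℕ) (r : ℚ_[p]) : Prop :=
  ∃ s : SomosState p, SomosReach m a b c d N (n - 3) s ∧ PadicCongr (N : ℤ) r s.d

/-- The map `f (a, b, c, d) = (b, c, d, (b d + c ^ 2) / a)` (meaningful for `a ≠ 0`). -/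
noncomputable def somosMap {p : ℕ} [Fact p.Prime] (x : Fin 4 → ℚ_[p]) : Fin 4 → ℚ_[p] :=
  ![x 1, x 2, x 3, (x 1 * x 3 + x 2 ^ 2) / x 0]

/-- The Jacobian matrix `D(a, b, c, d)` of `somosMap`. -/
noncomputable def somosJacobian {p : ℕ} [Fact p.Prime] (a b c d : ℚ_[p]) :
    Matrix (Fin 4) (Fin 4) ℚ_[p] :=
  !![0, 1, 0, 0;
     0, 0, 1, 0;
     0, 0, 0, 1;
     -(b * d + c ^ 2) / a ^ 2, d / a, 2 * c / a, b / a]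

/-- `D_i = D(u_{i-1}, u_i, u_{i+1}, u_{i+2}) ⋯ D(u_0, u_1, u_2, u_3)`. -/
noncomputable def somosD {p : ℕ} [Fact p.Prime] (u : ℕ → ℚ_[p]) :
    ℕ → Matrix (Fin 4) (Fin 4) ℚ_[p]
  | 0 => 1
  | i + 1 => somosJacobian (u i) (u (i + 1)) (u (i + 2)) (u (i + 3)) * somosD u i

/-! Put `q = p ^ N` and perturb the initial units to `x j + q * w j` with `w` in `ℤ_p ^ 4`. The
Laurent phenomenon holds over every commutative ring (`exists_somos_of_units`), so it can be applied
in the ring of functions of `w` that have a first order Taylor expansion with error `q ^ 2` times a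
1-Lipschitz function. This gives functions `U k`, with constant terms `u k`, for which four
consecutive linear parts form the matrix `D_i`.

The determinant of `D_i` telescopes to `u i * u (i + 1) * u (i + 2) * u (i + 3)` up to a unit. By
coprimality at most one of these factors is a nonunit, and none is divisible by `q`, so `p * det
D_i` divides `q` (`norm_q_le`). The error term is then `q * D_i` applied to `p` times a 1-Lipschitz
map. A contraction argument shows that `w ↦ (U i w, ..., U (i + 3) w)` maps onto the whole coset of
`q * D_i ℤ_p ^ 4`.

This coset is stable under perturbations by `q * det D_i`, and the working precision is at least
that fine. Hence every lift and every truncation in the loop lands exactly on some `U · w'`: each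
state lies on an exact SOMOS sequence congruent to `u` modulo `q`, and the valuations read off are
those of `u` (`exists_U_eq`, `Inv.step`). -/

/-! ### The Laurent phenomenon over a commutative ring -/

/-- Eight consecutive terms of a SOMOS 4 sequence in a commutative ring, such that each of the
last four is coprime to the three terms before it. -/
structure SomosWindow (R : Type*) [CommRing R] where
  (v0 v1 v2 v3 v4 v5 v6 v7 : R)
  rel0 : v0 * v4 = v1 * v3 + v2 ^ 2
  rel1 : v1 * v5 = v2 * v4 + v3 ^ 2
  rel2 : v2 * v6 = v3 * v5 + v4 ^ 2
  rel3 : v3 * v7 = v4 * v6 + v5 ^ 2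
  cop14 : IsCoprime v1 v4
  cop24 : IsCoprime v2 v4
  cop34 : IsCoprime v3 v4
  cop25 : IsCoprime v2 v5
  cop35 : IsCoprime v3 v5
  cop45 : IsCoprime v4 v5
  cop36 : IsCoprime v3 v6
  cop46 : IsCoprime v4 v6
  cop56 : IsCoprime v5 v6
  cop47 : IsCoprime v4 v7
  cop57 : IsCoprime v5 v7
  cop67 : IsCoprime v6 v7

namespace SomosWindow

variable {R : Type*} [CommRing R]

/-- The divisibility behind the Laurent phenomenon. -/
theorem dvd_next (s : SomosWindow R) : s.v4 ∣ s.v5 * s.v7 + s.v6 ^ 2 := by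
  have hcop : IsCoprime s.v4 (s.v1 * s.v2 ^ 2 * s.v3) :=
    ((s.cop14.mul_left s.cop24.pow_left).mul_left s.cop34).symm
  refine hcop.dvd_of_dvd_mul_left ?_
  obtain ⟨v0, v1, v2, v3, v4, v5, v6, v7, h0, h1, h2, h3, -⟩ := s
  dsimp only
  -- Modulo `v4` the relations read `v3 * v7 = v5 ^ 2`, `v2 * v6 = v3 * v5`, `v1 * v5 = v3 ^ 2` and
  -- `v1 * v3 + v2 ^ 2 = 0`. They turn `v1 * v2 ^ 2 * v3` times the target into `v3 ^ 2 * v5 ^ 2 *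
  -- (v1 * v3 + v2 ^ 2)`; the witness collects the multiples of `v4` dropped on the way.
  refine ⟨v1 * v2 ^ 2 * v5 * v6 + v1 * v3 * (v4 ^ 3 + 2 * v3 * v4 * v5) +
    v5 ^ 2 * v2 ^ 3 + v5 ^ 2 * v3 ^ 2 * v0, ?_⟩
  linear_combination v1 * v2 ^ 2 * v5 * h3 + v1 * v3 * (v2 * v6 + v3 * v5 + v4 ^ 2) * h2 +
    v5 ^ 2 * (v2 ^ 2) * h1 - v3 ^ 2 * v5 ^ 2 * h0

/-- Since `v4 * e = v5 * v7 + v6 ^ 2`, this product is `v6 ^ 2` modulo `v5` and modulo `v7`, and `v5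
* v7` modulo `v6`. Coprimality of the old terms therefore passes to `e`. -/
theorem exists_next (s : SomosWindow R) : ∃ t : SomosWindow R,
    t.v0 = s.v1 ∧ t.v1 = s.v2 ∧ t.v2 = s.v3 ∧ t.v3 = s.v4 ∧ t.v4 = s.v5 ∧ t.v5 = s.v6 ∧
      t.v6 = s.v7 := by
  obtain ⟨e, he⟩ := s.dvd_next
  have h5 : IsCoprime s.v5 (s.v4 * e) := by
    rw [← he, add_comm]; exact IsCoprime.add_mul_left_right s.cop56.pow_right _
  have h6 : IsCoprime s.v6 (s.v4 * e) := by
    rw [← he, sq]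
    exact IsCoprime.add_mul_left_right (s.cop56.symm.mul_right s.cop67) _
  have h7 : IsCoprime s.v7 (s.v4 * e) := by
    rw [← he, add_comm]; exact IsCoprime.add_mul_right_right s.cop67.symm.pow_right _
  exact ⟨⟨s.v1, s.v2, s.v3, s.v4, s.v5, s.v6, s.v7, e, s.rel1, s.rel2, s.rel3, he.symm, s.cop25,
    s.cop35, s.cop45, s.cop36, s.cop46, s.cop56, s.cop47, s.cop57, s.cop67,
    h5.of_mul_right_right, h6.of_mul_right_right, h7.of_mul_right_right⟩,
    rfl, rfl, rfl, rfl, rfl, rfl, rfl⟩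

/-- The recurrence can be run backwards four steps from units; coprimality is automatic because each
pair contains a unit. -/
theorem exists_of_units (x : Fin 4 → Rˣ) : ∃ s : SomosWindow R,
    s.v4 = x 0 ∧ s.v5 = x 1 ∧ s.v6 = x 2 ∧ s.v7 = x 3 := by
  have key (z : R) (y : Rˣ) : ∃ e, e * (y : R) = z := ⟨z * ↑y⁻¹, by simp⟩
  obtain ⟨v3, h3⟩ := key (x 0 * x 2 + (x 1 : R) ^ 2) (x 3)
  obtain ⟨v2, h2⟩ := key (v3 * x 1 + (x 0 : R) ^ 2) (x 2)
  obtain ⟨v1, h1⟩ := key (v2 * x 0 + v3 ^ 2) (x 1)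
  obtain ⟨v0, h0⟩ := key (v1 * v3 + v2 ^ 2) (x 0)
  have hc (z : R) (y : Rˣ) : IsCoprime z (y : R) := ⟨0, ↑y⁻¹, by simp⟩
  exact ⟨⟨v0, v1, v2, v3, x 0, x 1, x 2, x 3, h0, h1, h2, h3, hc _ _, hc _ _, hc _ _, hc _ _,
    hc _ _, hc _ _, hc _ _, hc _ _, hc _ _, hc _ _, hc _ _, hc _ _⟩, rfl, rfl, rfl, rfl⟩

end SomosWindow

/-- The Laurent phenomenon: four units of a commutative ring are the first terms of a SOMOS 4
sequence in this ring, and any four consecutive terms are pairwise coprime. -/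
theorem exists_somos_of_units {R : Type*} [CommRing R] (x : Fin 4 → Rˣ) : ∃ U : ℕ → R,
    (U 0 = x 0 ∧ U 1 = x 1 ∧ U 2 = x 2 ∧ U 3 = x 3) ∧
    (∀ k, U k * U (k + 4) = U (k + 1) * U (k + 3) + U (k + 2) ^ 2) ∧
    ∀ k, IsCoprime (U k) (U (k + 1)) ∧ IsCoprime (U k) (U (k + 2)) ∧
      IsCoprime (U k) (U (k + 3)) := by
  obtain ⟨s, hs0, hs1, hs2, hs3⟩ := SomosWindow.exists_of_units x
  choose next n0 n1 n2 n3 n4 n5 n6 using SomosWindow.exists_next (R := R)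
  set w : ℕ → SomosWindow R := fun k => next^[k] s with hw
  have hsucc (k) : w (k + 1) = next (w k) := Function.iterate_succ_apply' _ _ _
  have e1 (k) : (w (k + 1)).v4 = (w k).v5 := by rw [hsucc, n4]
  have e2 (k) : (w (k + 2)).v4 = (w k).v6 := by rw [e1, hsucc, n5]
  have e3 (k) : (w (k + 3)).v4 = (w k).v7 := by rw [e2, hsucc, n6]
  refine ⟨fun k => (w k).v4, ⟨hs0, ?_, ?_, ?_⟩, fun k => ?_, fun k => ?_⟩
  · exact (e1 0).trans hs1
  · exact (e2 0).trans hs2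
  · exact (e3 0).trans hs3
  · have h := (w (k + 1)).rel3
    rw [← e3, ← e2, ← e1, show (w (k + 1)).v3 = (w k).v4 by rw [hsucc, n3]] at h
    exact h
  · dsimp only
    rw [e1, e2, e3]
    exact ⟨(w k).cop45, (w k).cop46, (w k).cop47⟩

/-! ### The ring of functions with a first order Taylor expansion -/

section TaylorSubring

variable {p : ℕ} [Fact p.Prime] {ι : Type*} [Fintype ι]

theorem PadicInt.norm_dotProduct_le (v w : ι → ℤ_[p]) : ‖v ⬝ᵥ w‖ ≤ ‖w‖ := by
  refine IsUltrametricDist.norm_sum_le_of_forall_le_of_nonneg (norm_nonneg _) fun j _ => ?_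
  rw [norm_mul]
  exact (mul_le_of_le_one_left (norm_nonneg _) (PadicInt.norm_le_one _)).trans (norm_le_pi_norm w j)

theorem PadicInt.norm_pi_le_one (w : ι → ℤ_[p]) : ‖w‖ ≤ 1 :=
  (pi_norm_le_iff_of_nonneg zero_le_one).2 fun _ => PadicInt.norm_le_one _

theorem PadicInt.norm_add_le_of_le {x y : ℤ_[p]} {r : ℝ} (hx : ‖x‖ ≤ r) (hy : ‖y‖ ≤ r) :
    ‖x + y‖ ≤ r :=
  (PadicInt.nonarchimedean x y).trans (max_le hx hy)

theorem PadicInt.norm_mul_le_right (x y : ℤ_[p]) : ‖x * y‖ ≤ ‖y‖ := by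
  rw [norm_mul]; exact mul_le_of_le_one_left (norm_nonneg _) (PadicInt.norm_le_one _)

/-- `HasTaylor q F c L`: the function `F` on `ℤ_p ^ ι` is `c + q L + q ^ 2 G` with a
1-Lipschitz function `G` vanishing at `0`. -/
def HasTaylor (q : ℤ_[p]) (F : (ι → ℤ_[p]) → ℤ_[p]) (c : ℤ_[p]) (L : ι → ℤ_[p]) : Prop :=
  F 0 = c ∧ ∀ w w', ‖F w - F w' - q * (L ⬝ᵥ (w - w'))‖ ≤ ‖q‖ ^ 2 * ‖w - w'‖

namespace HasTaylor

variable {q : ℤ_[p]} {F F' : (ι → ℤ_[p]) → ℤ_[p]} {c c' : ℤ_[p]} {L L' : ι → ℤ_[p]}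

theorem norm_sub_le (h : HasTaylor q F c L) (w w' : ι → ℤ_[p]) :
    ‖F w - F w'‖ ≤ ‖q‖ * ‖w - w'‖ := by
  rw [← sub_add_cancel (F w - F w') (q * (L ⬝ᵥ (w - w')))]
  refine PadicInt.norm_add_le_of_le ((h.2 w w').trans ?_) ?_
  · rw [sq, mul_assoc]
    exact mul_le_of_le_one_left (by positivity) (PadicInt.norm_le_one _)
  · rw [norm_mul]
    gcongr
    exact PadicInt.norm_dotProduct_le _ _

theorem norm_sub_const_le (h : HasTaylor q F c L) (w : ι → ℤ_[p]) : ‖F w - c‖ ≤ ‖q‖ := by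
  rw [← h.1]
  exact (h.norm_sub_le w 0).trans
    (mul_le_of_le_one_right (norm_nonneg _) (PadicInt.norm_pi_le_one _))

theorem const (c : ℤ_[p]) : HasTaylor q (fun _ : ι → ℤ_[p] => c) c 0 :=
  ⟨rfl, fun w w' => by
    simp only [sub_self, zero_dotProduct, mul_zero, norm_zero]
    positivity⟩

theorem add (h : HasTaylor q F c L) (h' : HasTaylor q F' c' L') :
    HasTaylor q (F + F') (c + c') (L + L') := by
  refine ⟨by simp [h.1, h'.1], fun w w' => ?_⟩
  convert PadicInt.norm_add_le_of_le (h.2 w w') (h'.2 w w') using 2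
  rw [Pi.add_apply, Pi.add_apply, add_dotProduct]
  ring

theorem neg (h : HasTaylor q F c L) : HasTaylor q (-F) (-c) (-L) := by
  refine ⟨by simp [h.1], fun w w' => ?_⟩
  refine (le_of_eq ?_).trans (h.2 w w')
  rw [← norm_neg (F w - F w' - _), Pi.neg_apply, Pi.neg_apply, neg_dotProduct]
  congr 1
  ring

theorem norm_mul_mul_le {x y : ℤ_[p]} (hx : ‖x‖ ≤ ‖q‖) (L v : ι → ℤ_[p]) :
    ‖y * x * (q * (L ⬝ᵥ v))‖ ≤ ‖q‖ ^ 2 * ‖v‖ := by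
  rw [mul_assoc]
  refine (PadicInt.norm_mul_le_right _ _).trans ?_
  rw [norm_mul, norm_mul, sq, mul_assoc]
  gcongr
  exact PadicInt.norm_dotProduct_le _ _

theorem mul (h : HasTaylor q F c L) (h' : HasTaylor q F' c' L') :
    HasTaylor q (F * F') (c * c') (c • L' + c' • L) := by
  refine ⟨by simp [h.1, h'.1], fun w w' => ?_⟩
  -- The last two terms come from replacing `F w` and `F' w'` by `c` and `c'`; each replacement
  -- costs a multiple of `q`, hence an error of order `q ^ 2`. The factors `1` fit the shape of
  -- `norm_mul_mul_le`.
  have e : (F * F') w - (F * F') w' - q * ((c • L' + c' • L) ⬝ᵥ (w - w')) =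
      F w * (F' w - F' w' - q * (L' ⬝ᵥ (w - w'))) + F' w' * (F w - F w' - q * (L ⬝ᵥ (w - w'))) +
      (1 * (F w - c) * (q * (L' ⬝ᵥ (w - w'))) + 1 * (F' w' - c') * (q * (L ⬝ᵥ (w - w')))) := by
    simp only [Pi.mul_apply, add_dotProduct, smul_dotProduct, smul_eq_mul]
    ring
  rw [e]
  exact PadicInt.norm_add_le_of_le
    (PadicInt.norm_add_le_of_le ((PadicInt.norm_mul_le_right _ _).trans (h'.2 w w'))
      ((PadicInt.norm_mul_le_right _ _).trans (h.2 w w')))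
    (PadicInt.norm_add_le_of_le (norm_mul_mul_le (h.norm_sub_const_le w) _ _)
      (norm_mul_mul_le (h'.norm_sub_const_le w') _ _))

theorem inv (h : HasTaylor q F c L) (hF : F * F' = 1) (hc : c * c' = 1) :
    HasTaylor q F' c' (-(c' ^ 2) • L) := by
  have hF1 (w) : F w * F' w = 1 := congrFun hF w
  refine ⟨?_, fun w w' => ?_⟩
  · have h0 := hF1 0
    rw [h.1] at h0
    linear_combination c' * h0 - F' 0 * hc
  -- The difference of inverses is `-(F' w * F' w') * (F w - F w')`. Replacing `F' w * F' w'` by `c'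
  -- ^ 2` costs a multiple of `F w * F w' - c ^ 2 = F w * (F w' - c) + c * (F w - c)`, which is
  -- divisible by `q`.
  have e : F' w - F' w' - q * ((-(c' ^ 2) • L) ⬝ᵥ (w - w')) =
      -(F' w * F' w') * (F w - F w' - q * (L ⬝ᵥ (w - w'))) +
      ((c' ^ 2 * F' w * F' w' * F w) * (F w' - c) * (q * (L ⬝ᵥ (w - w'))) +
        (c' ^ 2 * F' w * F' w' * c) * (F w - c) * (q * (L ⬝ᵥ (w - w')))) := by
    simp only [smul_dotProduct, smul_eq_mul]
    generalize L ⬝ᵥ (w - w') = l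
    have h1 := hF1 w
    have h2 := hF1 w'
    have hd : F' w - F' w' = -(F' w * F' w') * (F w - F w') := by
      linear_combination F' w' * h1 - F' w * h2
    have hq : c' ^ 2 - F' w * F' w' = c' ^ 2 * F' w * F' w' * (F w * F w' - c ^ 2) := by
      linear_combination F' w * F' w' * (c * c' + 1) * hc -
        c' ^ 2 * F w' * F' w' * h1 - c' ^ 2 * h2
    linear_combination hd + q * l * hq
  rw [e]
  refine PadicInt.norm_add_le_of_le ?_ (PadicInt.norm_add_le_of_le
    (norm_mul_mul_le (h.norm_sub_const_le w') _ _) (norm_mul_mul_le (h.norm_sub_const_le w) _ _))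
  exact (PadicInt.norm_mul_le_right _ _).trans (h.2 w w')

theorem coord (q c : ℤ_[p]) [DecidableEq ι] (i : ι) :
    HasTaylor q (fun w => c + q * w i) c (Pi.single i 1) := by
  refine ⟨by simp, fun w w' => ?_⟩
  rw [show c + q * w i - (c + q * w' i) - q * (Pi.single i 1 ⬝ᵥ (w - w')) = 0 by simp; ring, norm_zero]
  positivity

end HasTaylor

/-- The functions with a Taylor expansion, together with their expansions to the first order. -/
def taylorSubring (q : ℤ_[p]) (ι : Type*) [Fintype ι] :
    Subring (((ι → ℤ_[p]) → ℤ_[p]) × TrivSqZeroExt ℤ_[p] (ι → ℤ_[p])) where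
  carrier := {F | HasTaylor q F.1 F.2.fst F.2.snd}
  mul_mem' {F F'} h h' := by
    simpa using HasTaylor.mul h h'
  one_mem' := HasTaylor.const 1
  add_mem' h h' := HasTaylor.add h h'
  zero_mem' := HasTaylor.const 0
  neg_mem' h := HasTaylor.neg h

end TaylorSubring

/-! ### Images of Taylor maps as cosets of a lattice -/

section TaylorSurjective

variable {p : ℕ} [Fact p.Prime]

theorem PadicInt.exists_eq_mul_of_norm_le {x y : ℤ_[p]} (h : ‖x‖ ≤ ‖y‖) : ∃ z, x = y * z := by
  rcases eq_or_ne y 0 with rfl | hy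
  · exact ⟨0, by simpa using h⟩
  have hy' : (y : ℚ_[p]) ≠ 0 := by simpa using hy
  refine ⟨⟨x / y, ?_⟩, ?_⟩
  · rw [norm_div, ← PadicInt.norm_def, ← PadicInt.norm_def]
    exact div_le_one_of_le₀ h (norm_nonneg _)
  · apply Subtype.ext
    change (x : ℚ_[p]) = y * (x / y)
    field_simp

variable {ι : Type*} [Fintype ι] {q : ℤ_[p]}

theorem HasTaylor.exists_remainder {F : (ι → ℤ_[p]) → ℤ_[p]} {c : ℤ_[p]} {L : ι → ℤ_[p]}
    (h : HasTaylor q F c L) (hq : q ≠ 0) : ∃ G : (ι → ℤ_[p]) → ℤ_[p],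
      (∀ w, F w = c + q * (L ⬝ᵥ w) + q ^ 2 * G w) ∧ ∀ w w', ‖G w - G w'‖ ≤ ‖w - w'‖ := by
  have h1 (w : ι → ℤ_[p]) : ∃ z, F w - c - q * (L ⬝ᵥ w) = q ^ 2 * z := by
    apply PadicInt.exists_eq_mul_of_norm_le
    have := h.2 w 0
    rw [h.1, sub_zero] at this
    rw [norm_pow]
    exact this.trans (mul_le_of_le_one_right (by positivity) (PadicInt.norm_pi_le_one _))
  choose G hG using h1
  refine ⟨G, fun w => by rw [← hG]; ring, fun w w' => ?_⟩
  have h2 := h.2 w w'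
  rw [dotProduct_sub, show F w - F w' - q * (L ⬝ᵥ w - L ⬝ᵥ w') = q ^ 2 * (G w - G w') by
    linear_combination hG w - hG w', norm_mul, norm_pow] at h2
  exact le_of_mul_le_mul_left h2 (pow_pos (norm_pos_iff.2 hq) 2)

theorem PadicInt.norm_mulVec_le {κ : Type*} [Fintype κ] (M : Matrix κ ι ℤ_[p]) (w : ι → ℤ_[p]) :
    ‖M.mulVec w‖ ≤ ‖w‖ :=
  (pi_norm_le_iff_of_nonneg (norm_nonneg _)).2 fun _ => PadicInt.norm_dotProduct_le _ _

/-- A contraction by the factor `p` has a fixed point. -/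
theorem PadicInt.exists_eq_sub_p_smul {G : (ι → ℤ_[p]) → ι → ℤ_[p]}
    (hG : ∀ w w', ‖G w - G w'‖ ≤ ‖w - w'‖) (w₀ : ι → ℤ_[p]) :
    ∃ w, w = w₀ - (p : ℤ_[p]) • G w := by
  have hK : ‖(p : ℤ_[p])‖₊ < 1 := by
    rw [← NNReal.coe_lt_coe]
    simpa using inv_lt_one_of_one_lt₀ (Nat.one_lt_cast.2 (Fact.out : p.Prime).one_lt)
  have hc : ContractingWith ‖(p : ℤ_[p])‖₊ fun w => w₀ - (p : ℤ_[p]) • G w := by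
    refine ⟨hK, LipschitzWith.of_dist_le_mul fun w w' => ?_⟩
    rw [dist_eq_norm, dist_eq_norm, sub_sub_sub_cancel_left, ← smul_sub, norm_sub_rev w w']
    refine (norm_smul_le _ _).trans ?_
    exact mul_le_mul_of_nonneg_left (hG _ _) (norm_nonneg _)
  exact ⟨_, hc.fixedPoint_isFixedPt.symm⟩

variable [DecidableEq ι] {Φ : ι → (ι → ℤ_[p]) → ℤ_[p]} {c : ι → ℤ_[p]} {M : Matrix ι ι ℤ_[p]}

/-- With `q = p * det M * r` and `det M = M * adjugate M`, the quadratic error `q ^ 2 * G` becomes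
`q * M` applied to `p * r * adjugate M * G`. -/
theorem HasTaylor.exists_remainder_vec (h : ∀ j, HasTaylor q (Φ j) (c j) (M j)) (hq : q ≠ 0)
    (hM : ‖q‖ ≤ ‖p * M.det‖) : ∃ G : (ι → ℤ_[p]) → ι → ℤ_[p],
      (∀ w, (fun j => Φ j w) = c + q • M.mulVec (w + (p : ℤ_[p]) • G w)) ∧
      ∀ w w', ‖G w - G w'‖ ≤ ‖w - w'‖ := by
  choose G hG hGl using fun j => (h j).exists_remainder hq
  obtain ⟨r, hr⟩ := PadicInt.exists_eq_mul_of_norm_le hM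
  refine ⟨fun w => (r • M.adjugate).mulVec fun j => G j w, fun w => ?_, fun w w' => ?_⟩
  · rw [Matrix.mulVec_add, Matrix.mulVec_smul, Matrix.mulVec_mulVec, Matrix.mul_smul,
      Matrix.mul_adjugate]
    ext j
    simp only [hG, Pi.add_apply, Pi.smul_apply, smul_eq_mul, Matrix.smul_mulVec,
      Matrix.one_mulVec, Matrix.mulVec]
    linear_combination q * G j w * hr
  · rw [← Matrix.mulVec_sub]
    refine (PadicInt.norm_mulVec_le _ _).trans ?_
    exact (pi_norm_le_iff_of_nonneg (norm_nonneg _)).2 fun j => hGl j w w'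

theorem HasTaylor.exists_mulVec_eq (h : ∀ j, HasTaylor q (Φ j) (c j) (M j)) (hq : q ≠ 0)
    (hM : ‖q‖ ≤ ‖p * M.det‖) (w : ι → ℤ_[p]) :
    ∃ w', (fun j => Φ j w) = c + q • M.mulVec w' := by
  obtain ⟨G, hG, -⟩ := HasTaylor.exists_remainder_vec h hq hM
  exact ⟨_, hG w⟩

/-- Surjectivity onto the coset: the equation `w' + p * G w' = w` is a fixed point problem for a
contraction. -/
theorem HasTaylor.exists_eq_mulVec (h : ∀ j, HasTaylor q (Φ j) (c j) (M j)) (hq : q ≠ 0)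
    (hM : ‖q‖ ≤ ‖p * M.det‖) (w : ι → ℤ_[p]) :
    ∃ w', (fun j => Φ j w') = c + q • M.mulVec w := by
  obtain ⟨G, hG, hGl⟩ := HasTaylor.exists_remainder_vec h hq hM
  obtain ⟨w', hw'⟩ := PadicInt.exists_eq_sub_p_smul hGl w
  exact ⟨w', by rw [hG, ← eq_sub_iff_add_eq.1 hw']⟩

/-- The lattice `M ℤ_p ^ ι` contains `det M * ℤ_p ^ ι`, by the adjugate. -/
theorem PadicInt.exists_smul_mulVec_eq {v : ι → ℤ_[p]} (hv : ∀ j, ‖v j‖ ≤ ‖q * M.det‖) :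
    ∃ w, v = q • M.mulVec w := by
  choose z hz using fun j => PadicInt.exists_eq_mul_of_norm_le (hv j)
  refine ⟨M.adjugate.mulVec z, ?_⟩
  rw [Matrix.mulVec_mulVec, Matrix.mul_adjugate, Matrix.smul_mulVec, Matrix.one_mulVec]
  ext j
  simp [hz, mul_assoc]

end TaylorSurjective

/-! ### SOMOS sequences of functions with Taylor expansions -/

section Expansion

variable {p : ℕ} [Fact p.Prime]

/-- A SOMOS 4 sequence of functions on `ℤ_p ^ 4` with initial terms `x j + q w j`, together with
Taylor expansions of its terms at `w = 0`. -/
structure SomosExpansion (q : ℤ_[p]) (x : Fin 4 → ℤ_[p]) where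
  U : ℕ → (Fin 4 → ℤ_[p]) → ℤ_[p]
  c : ℕ → ℤ_[p]
  L : ℕ → Fin 4 → ℤ_[p]
  taylor : ∀ k, HasTaylor q (U k) (c k) (L k)
  rel : ∀ k w, U k w * U (k + 4) w = U (k + 1) w * U (k + 3) w + U (k + 2) w ^ 2
  relL : ∀ k, c k • L (k + 4) + c (k + 4) • L k =
    c (k + 1) • L (k + 3) + c (k + 3) • L (k + 1) + (2 * c (k + 2)) • L (k + 2)
  coprime : ∀ k, IsCoprime (c k) (c (k + 1)) ∧ IsCoprime (c k) (c (k + 2)) ∧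
    IsCoprime (c k) (c (k + 3))
  c_init : ∀ j : Fin 4, c j = x j
  L_init : ∀ j : Fin 4, L j = Pi.single j 1

/-- As `q` is a nonunit, `x + q * w i` is a unit at every `w`; its pointwise inverse has a Taylor
expansion too, so the inverse stays in the subring. -/
theorem taylorSubring.exists_unit {q : ℤ_[p]} (hq : ‖q‖ < 1) {x : ℤ_[p]} (hx : ‖x‖ = 1)
    {ι : Type*} [Fintype ι] [DecidableEq ι] (i : ι) :
    ∃ y : (taylorSubring q ι)ˣ, ((y : taylorSubring q ι) :
      ((ι → ℤ_[p]) → ℤ_[p]) × TrivSqZeroExt ℤ_[p] (ι → ℤ_[p])) =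
      (fun w => x + q * w i, TrivSqZeroExt.inl x + TrivSqZeroExt.inr (Pi.single i 1)) := by
  have h := HasTaylor.coord q x i
  have hu (w : ι → ℤ_[p]) : ‖x + q * w i‖ = 1 := by
    have h1 : ‖q * w i‖ < 1 := by
      rw [mul_comm]
      exact (PadicInt.norm_mul_le_right _ _).trans_lt hq
    rw [PadicInt.norm_add_eq_max_of_ne (by rw [hx]; exact h1.ne'), hx, max_eq_left h1.le]
  obtain ⟨c', hc⟩ := (PadicInt.isUnit_iff.2 hx).exists_right_inv
  choose F' hF using fun w => (PadicInt.isUnit_iff.2 (hu w)).exists_right_inv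
  have h' := h.inv (funext hF) hc
  have hmul : ((fun w => x + q * w i, TrivSqZeroExt.inl x + TrivSqZeroExt.inr (Pi.single i 1)) :
      ((ι → ℤ_[p]) → ℤ_[p]) × TrivSqZeroExt ℤ_[p] (ι → ℤ_[p])) *
      (F', TrivSqZeroExt.inl c' + TrivSqZeroExt.inr (-(c' ^ 2) • Pi.single i 1)) = 1 := by
    refine Prod.ext (funext hF) (TrivSqZeroExt.ext (by simpa using hc) ?_)
    ext j
    simp
    linear_combination (-(c' * (Pi.single i 1 : ι → ℤ_[p]) j)) * hc
  have m1 : ((fun w => x + q * w i, TrivSqZeroExt.inl x + TrivSqZeroExt.inr (Pi.single i 1)) :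
      ((ι → ℤ_[p]) → ℤ_[p]) × TrivSqZeroExt ℤ_[p] (ι → ℤ_[p])) ∈ taylorSubring q ι := by
    change HasTaylor _ _ _ _
    simpa using h
  have m2 : (F', TrivSqZeroExt.inl c' + TrivSqZeroExt.inr (-(c' ^ 2) • Pi.single i 1)) ∈
      taylorSubring q ι := by
    change HasTaylor _ _ _ _
    simpa using h'
  exact ⟨Units.mkOfMulEqOne ⟨_, m1⟩ ⟨_, m2⟩ (Subtype.ext hmul), rfl⟩

theorem SomosExpansion.nonempty {q : ℤ_[p]} (hq : ‖q‖ < 1) {x : Fin 4 → ℤ_[p]}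
    (hx : ∀ j, ‖x j‖ = 1) : Nonempty (SomosExpansion q x) := by
  choose y hy using fun j => taylorSubring.exists_unit hq (hx j) j
  obtain ⟨V, ⟨h0, h1, h2, h3⟩, hrel, hcop⟩ := exists_somos_of_units y
  have hinit (j : Fin 4) : V j = y j := by
    fin_cases j
    exacts [h0, h1, h2, h3]
  let ev : taylorSubring q (Fin 4) →+* ℤ_[p] :=
    ((TrivSqZeroExt.fstHom ℤ_[p] ℤ_[p] (Fin 4 → ℤ_[p])).toRingHom.comp (RingHom.snd _ _)).comp
      (taylorSubring q (Fin 4)).subtype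
  have hrel' (k) := congrArg Subtype.val (hrel k)
  refine ⟨⟨fun k => (V k).1.1, fun k => (V k).1.2.fst, fun k => (V k).1.2.snd,
    fun k => (V k).2, fun k w => ?_, fun k => ?_, fun k => ?_, fun j => ?_, fun j => ?_⟩⟩
  · exact congrFun (congrArg Prod.fst (hrel' k)) w
  -- The square-zero component of the recurrence is its differential.
  · have := congrArg (fun z => z.2.snd) (hrel' k)
    simpa [sq, two_mul, add_smul, TrivSqZeroExt.snd_mul] using this
  · exact ⟨(hcop k).1.map ev, (hcop k).2.1.map ev, (hcop k).2.2.map ev⟩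
  · simp only [hinit, hy]
    simp
  · simp only [hinit, hy]
    simp

end Expansion

/-! ### Norms, the Jacobian and the differentials of the iterates -/

section Invariant

variable {p : ℕ} [Fact p.Prime]

theorem padicCongr_iff {k : ℤ} {x y : ℚ_[p]} :
    PadicCongr k x y ↔ ‖x - y‖ ≤ (p : ℝ) ^ (-k) := by
  have hp : (p : ℚ_[p]) ≠ 0 := Nat.cast_ne_zero.2 (Fact.out : p.Prime).ne_zero
  have hp' : (0 : ℝ) < p := Nat.cast_pos.2 (Fact.out : p.Prime).pos
  constructor
  · rintro ⟨z, hz⟩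
    rw [hz, norm_mul, Padic.norm_p_zpow]
    exact mul_le_of_le_one_right (by positivity) (PadicInt.norm_le_one z)
  · intro h
    refine ⟨⟨(x - y) / (p : ℚ_[p]) ^ k, ?_⟩, ?_⟩
    · rw [norm_div, Padic.norm_p_zpow]
      exact div_le_one_of_le₀ h (by positivity)
    · field_simp

theorem Padic.norm_add_eq_left {x y : ℚ_[p]} (h : ‖y‖ < ‖x‖) : ‖x + y‖ = ‖x‖ := by
  rw [Padic.add_eq_max_of_ne h.ne', max_eq_left h.le]

theorem Padic.valuation_eq_of_norm_eq {x y : ℚ_[p]} (hy : y ≠ 0) (h : ‖x‖ = ‖y‖) :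
    x.valuation = y.valuation := by
  have hx : x ≠ 0 := by rw [← norm_ne_zero_iff, h, norm_ne_zero_iff]; exact hy
  rw [Padic.norm_eq_zpow_neg_valuation hx, Padic.norm_eq_zpow_neg_valuation hy] at h
  have hp : (1 : ℝ) < p := Nat.one_lt_cast.2 (Fact.out : p.Prime).one_lt
  exact neg_injective (zpow_right_injective₀ (by positivity) hp.ne' h)

theorem det_somosJacobian (a b c d : ℚ_[p]) :
    (somosJacobian a b c d).det = (b * d + c ^ 2) / a ^ 2 := by
  simp [somosJacobian, Matrix.det_succ_row_zero, Fin.sum_univ_succ, Fin.succAbove]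
  ring

theorem hasFDerivAt_somosMap {x : Fin 4 → ℚ_[p]} (h0 : x 0 ≠ 0) :
    HasFDerivAt (𝕜 := ℚ_[p]) somosMap
      (LinearMap.toContinuousLinearMap
        (Matrix.toLin' (somosJacobian (x 0) (x 1) (x 2) (x 3)))) x := by
  have hp (j : Fin 4) : HasFDerivAt (𝕜 := ℚ_[p]) (fun y : Fin 4 → ℚ_[p] => y j)
      (ContinuousLinearMap.proj j) x := hasFDerivAt_apply j x
  have hl := ((((hp 1).mul (hp 3)).add ((hp 2).pow 2)).mul ((hasDerivAt_inv h0).comp_hasFDerivAt x (hp 0)))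
  rw [hasFDerivAt_pi']
  intro j
  fin_cases j
  · refine (hp 1).congr_fderiv ?_
    ext v
    simp [somosJacobian, dotProduct, Fin.sum_univ_succ]
  · refine (hp 2).congr_fderiv ?_
    ext v
    simp [somosJacobian, dotProduct, Fin.sum_univ_succ]
  · refine (hp 3).congr_fderiv ?_
    ext v
    simp [somosJacobian, dotProduct, Fin.sum_univ_succ]
  · refine hl.congr_fderiv ?_
    ext v
    simp [somosJacobian, dotProduct, Fin.sum_univ_succ]
    field_simp
    ring

/-- The first `n + 1` terms of a SOMOS 4 sequence, all nonzero. -/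
structure IsSomos (u : ℕ → ℚ_[p]) (n : ℕ) : Prop where
  rel : ∀ k, k + 4 ≤ n → u k * u (k + 4) = u (k + 1) * u (k + 3) + u (k + 2) ^ 2
  ne_zero : ∀ k, k ≤ n → u k ≠ 0

namespace IsSomos

variable {u : ℕ → ℚ_[p]} {n : ℕ}

theorem somosMap_eq (h : IsSomos u n) {i : ℕ} (hi : i + 4 ≤ n) :
    somosMap ![u i, u (i + 1), u (i + 2), u (i + 3)] =
      ![u (i + 1), u (i + 2), u (i + 3), u (i + 4)] := by
  have h0 := h.ne_zero i (by omega)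
  simp [somosMap, ← h.rel i hi, h0]

theorem iterate_somosMap (h : IsSomos u n) {i : ℕ} (hi : i + 3 ≤ n) :
    somosMap^[i] ![u 0, u 1, u 2, u 3] = ![u i, u (i + 1), u (i + 2), u (i + 3)] := by
  induction i with
  | zero => rfl
  | succ i ih => rw [Function.iterate_succ_apply', ih (by omega), h.somosMap_eq (by omega)]

theorem hasFDerivAt_iterate (h : IsSomos u n) {i : ℕ} (hi : i + 3 ≤ n) :
    HasFDerivAt (𝕜 := ℚ_[p]) (somosMap^[i])
      (LinearMap.toContinuousLinearMap (Matrix.toLin' (somosD u i)))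
      ![u 0, u 1, u 2, u 3] := by
  induction i with
  | zero =>
    refine (hasFDerivAt_id _).congr_fderiv ?_
    ext v
    simp [somosD]
  | succ i ih =>
    rw [Function.iterate_succ']
    have hf := hasFDerivAt_somosMap (x := ![u i, u (i + 1), u (i + 2), u (i + 3)])
      (h.ne_zero i (by omega))
    rw [← h.iterate_somosMap (by omega)] at hf
    refine (hf.comp _ (ih (by omega))).congr_fderiv ?_
    rw [h.iterate_somosMap (by omega)]
    ext v
    simp [somosD]

/-- By the recurrence each Jacobian has determinant `u (i + 4) / u i`, so the product telescopes. -/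
theorem det_somosD (h : IsSomos u n) {i : ℕ} (hi : i + 3 ≤ n) :
    (somosD u i).det * (u 0 * u 1 * u 2 * u 3) = u i * u (i + 1) * u (i + 2) * u (i + 3) := by
  induction i with
  | zero => simp [somosD]
  | succ i ih =>
    have h0 := h.ne_zero i (by omega)
    rw [somosD, Matrix.det_mul, mul_assoc, ih (by omega), det_somosJacobian,
      ← h.rel i (by omega)]
    field_simp

end IsSomos

end Invariant

/-! ### Expansion around the given sequence -/

section Loop

variable {p : ℕ} [Fact p.Prime]

theorem PadicInt.norm_eq_one_or_of_isCoprime {x y : ℤ_[p]} (h : IsCoprime x y) :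
    ‖x‖ = 1 ∨ ‖y‖ = 1 := by
  rw [← PadicInt.isUnit_iff, ← PadicInt.isUnit_iff]
  obtain ⟨a, b, hab⟩ := h
  exact (IsLocalRing.isUnit_or_isUnit_of_add_one hab).imp isUnit_of_mul_isUnit_right
    isUnit_of_mul_isUnit_right

/-- The value group is discrete, so a strict inequality gains a factor `p`. -/
theorem PadicInt.norm_le_norm_p_mul {x y : ℤ_[p]} (h : ‖x‖ < ‖y‖) : ‖x‖ ≤ ‖p * y‖ := by
  obtain ⟨z, rfl⟩ := PadicInt.exists_eq_mul_of_norm_le h.le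
  have hz : ‖z‖ < 1 := by
    rw [norm_mul] at h
    by_contra! hz
    exact h.not_ge (le_mul_of_one_le_right (norm_nonneg _) hz)
  obtain ⟨r, rfl⟩ := PadicInt.norm_lt_one_iff_dvd z |>.1 hz
  rw [mul_left_comm, ← mul_assoc, mul_comm]
  exact PadicInt.norm_mul_le_right _ _

namespace SomosExpansion

variable {q : ℤ_[p]} {x : Fin 4 → ℤ_[p]} {u : ℕ → ℚ_[p]} {n : ℕ}

/-- The rows of `S.M i` are the first order terms of four consecutive terms. -/
def M (S : SomosExpansion q x) (i : ℕ) : Matrix (Fin 4) (Fin 4) ℤ_[p] :=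
  Matrix.of fun j => S.L (i + j)

theorem c_eq (S : SomosExpansion q x) (h : IsSomos u n) (hx : ∀ j : Fin 4, (x j : ℚ_[p]) = u j)
    (k : ℕ) (hk : k ≤ n) : (S.c k : ℚ_[p]) = u k := by
  induction k using Nat.strong_induction_on with
  | _ k ih =>
    by_cases hk4 : k < 4
    · rw [← hx ⟨k, hk4⟩, ← S.c_init]
    obtain ⟨k, rfl⟩ := Nat.exists_eq_add_of_le' (not_lt.1 hk4)
    have hr := S.rel k 0
    simp only [(S.taylor _).1] at hr
    have hr' := congrArg ((↑) : ℤ_[p] → ℚ_[p]) hr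
    push_cast at hr'
    rw [ih k (by omega) (by omega), ih (k + 1) (by omega) (by omega),
      ih (k + 2) (by omega) (by omega), ih (k + 3) (by omega) (by omega), ← h.rel k hk] at hr'
    exact mul_left_cancel₀ (h.ne_zero k (by omega)) hr'

/-- `S.Expands u n`: the constant terms of `S` are the terms of the SOMOS 4 sequence `u`, and
these are nonzero modulo `q`. -/
structure Expands (S : SomosExpansion q x) (u : ℕ → ℚ_[p]) (n : ℕ) : Prop where
  isSomos : IsSomos u n
  norm_init : ∀ j : Fin 4, ‖u j‖ = 1
  c_eq : ∀ k, k ≤ n → (S.c k : ℚ_[p]) = u k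
  norm_lt : ∀ k, k ≤ n → ‖q‖ < ‖u k‖

namespace Expands

variable {S : SomosExpansion q x}

theorem norm_le_one (h : S.Expands u n) {k : ℕ} (hk : k ≤ n) : ‖u k‖ ≤ 1 := by
  rw [← h.c_eq k hk]; exact PadicInt.norm_le_one _

theorem norm_U_sub_le (h : S.Expands u n) {k : ℕ} (hk : k ≤ n) (w : Fin 4 → ℤ_[p]) :
    ‖(S.U k w : ℚ_[p]) - u k‖ ≤ ‖q‖ := by
  rw [← h.c_eq k hk, ← PadicInt.coe_sub]
  exact (S.taylor k).norm_sub_const_le w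

/-- The perturbation is at most `‖q‖ < ‖u k‖`. This is why valuations read off from approximations
are the true ones. -/
theorem norm_U (h : S.Expands u n) {k : ℕ} (hk : k ≤ n) (w : Fin 4 → ℤ_[p]) :
    ‖(S.U k w : ℚ_[p])‖ = ‖u k‖ := by
  rw [← add_sub_cancel (u k) (S.U k w : ℚ_[p])]
  exact Padic.norm_add_eq_left ((h.norm_U_sub_le hk w).trans_lt (h.norm_lt k hk))

theorem isSomos_U (h : S.Expands u n) (w : Fin 4 → ℤ_[p]) :
    IsSomos (fun k => (S.U k w : ℚ_[p])) n where
  rel k _ := by exact_mod_cast congrArg ((↑) : ℤ_[p] → ℚ_[p]) (S.rel k w)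
  ne_zero k hk := by
    rw [← norm_ne_zero_iff, h.norm_U hk, norm_ne_zero_iff]
    exact h.isSomos.ne_zero k hk

/-- Multiplication by the Jacobian shifts the rows by one, and its last row is the linearized
recurrence `relL` solved for `L (i + 4)`. -/
theorem somosD_eq (h : S.Expands u n) {i : ℕ} (hi : i + 3 ≤ n) :
    somosD u i = (S.M i).map (PadicInt.Coe.ringHom (p := p)) := by
  induction i with
  | zero =>
    ext j k
    have hj := congrFun (S.L_init j) k
    simp [somosD, M, hj, Matrix.one_apply, Pi.single_apply, eq_comm]
  | succ i ih =>
    rw [somosD, ih (by omega)]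
    have h0 := h.isSomos.ne_zero i (by omega)
    ext j k
    fin_cases j
    · simp [somosJacobian, Matrix.mul_apply, Fin.sum_univ_succ, M]
    · simp [somosJacobian, Matrix.mul_apply, Fin.sum_univ_succ, M, add_assoc]
    · simp [somosJacobian, Matrix.mul_apply, Fin.sum_univ_succ, M, add_assoc]
    · have hL := congrArg ((↑) : ℤ_[p] → ℚ_[p]) (congrFun (S.relL i) k)
      simp only [Pi.add_apply, Pi.smul_apply, smul_eq_mul] at hL
      push_cast at hL
      rw [h.c_eq i (by omega), h.c_eq (i + 1) (by omega), h.c_eq (i + 2) (by omega),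
        h.c_eq (i + 3) (by omega), h.c_eq (i + 4) (by omega)] at hL
      simp [somosJacobian, Matrix.mul_apply, Fin.sum_univ_succ, M, add_assoc]
      have hr (z : ℤ_[p]) : PadicInt.Coe.ringHom z = (z : ℚ_[p]) := rfl
      have h2 : ((2 : ℤ_[p]) : ℚ_[p]) = 2 := rfl
      have hrel := h.isSomos.rel i (by omega)
      rw [h2] at hL
      simp only [hr]
      field_simp
      linear_combination (S.L i k : ℚ_[p]) * hrel - u i * hL

theorem det_somosD_eq (h : S.Expands u n) {i : ℕ} (hi : i + 3 ≤ n) :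
    (somosD u i).det = ((S.M i).det : ℚ_[p]) := by
  rw [h.somosD_eq hi]
  exact (RingHom.map_det _ _).symm

theorem norm_det_somosD (h : S.Expands u n) {i : ℕ} (hi : i + 3 ≤ n) :
    ‖(somosD u i).det‖ = ‖u i * u (i + 1) * u (i + 2) * u (i + 3)‖ := by
  rw [← h.isSomos.det_somosD hi]
  simp only [norm_mul]
  have h0 := h.norm_init 0
  have h1 := h.norm_init 1
  have h2 := h.norm_init 2
  have h3 := h.norm_init 3
  simp_all

theorem norm_det (h : S.Expands u n) {i : ℕ} (hi : i + 3 ≤ n) :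
    ‖(S.M i).det‖ = ‖u i‖ * ‖u (i + 1)‖ * ‖u (i + 2)‖ * ‖u (i + 3)‖ := by
  rw [PadicInt.norm_def, ← h.det_somosD_eq hi, h.norm_det_somosD hi]
  simp only [norm_mul]

/-- Four consecutive terms are pairwise coprime in a local ring, so at most one is a nonunit. The
determinant thus has the norm of a single term, which exceeds `‖q‖`. -/
theorem norm_q_le (h : S.Expands u n) {i : ℕ} (hi : i + 3 ≤ n) : ‖q‖ ≤ ‖p * (S.M i).det‖ := by
  apply PadicInt.norm_le_norm_p_mul
  rw [h.norm_det hi]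
  have key {k l : ℕ} (hk : k ≤ n) (hl : l ≤ n) (hc : IsCoprime (S.c k) (S.c l)) :
      ‖u k‖ = 1 ∨ ‖u l‖ = 1 := by
    rw [← h.c_eq k hk, ← h.c_eq l hl]
    exact PadicInt.norm_eq_one_or_of_isCoprime hc
  have l0 := h.norm_lt i (by omega)
  have l1 := h.norm_lt (i + 1) (by omega)
  have l2 := h.norm_lt (i + 2) (by omega)
  have l3 := h.norm_lt (i + 3) (by omega)
  have c01 := key (by omega) (by omega) (S.coprime i).1
  have c02 := key (by omega) (by omega) (S.coprime i).2.1
  have c03 := key (by omega) (by omega) (S.coprime i).2.2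
  have c12 := key (by omega) (by omega) (S.coprime (i + 1)).1
  have c13 := key (by omega) (by omega) (S.coprime (i + 1)).2.1
  have c23 := key (by omega) (by omega) (S.coprime (i + 2)).1
  simp only [add_assoc, Nat.reduceAdd] at c12 c13 c23
  rcases c01 with e | e <;> rcases c23 with e' | e'
  · rcases c13 with f | f <;> simpa [e, e', f]
  · rcases c12 with f | f <;> simpa [e, e', f]
  · rcases c03 with f | f <;> simpa [e, e', f]
  · rcases c02 with f | f <;> simpa [e, e', f]

/-- The image of `w ↦ (U i w, ..., U (i + 3) w)` is a coset of `q M_i ℤ_p ^ 4`. -/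
theorem exists_U_eq (h : S.Expands u n) (hq : q ≠ 0) {i : ℕ} (hi : i + 3 ≤ n)
    {y : Fin 4 → ℚ_[p]} (w : Fin 4 → ℤ_[p])
    (hy : ∀ j : Fin 4, ‖y j - S.U (i + j) w‖ ≤ ‖q * (S.M i).det‖) :
    ∃ w', ∀ j : Fin 4, y j = S.U (i + j) w' := by
  have hT (j : Fin 4) : HasTaylor q (S.U (i + j)) (S.c (i + j)) (S.M i j) := S.taylor _
  obtain ⟨w₀, hw₀⟩ := HasTaylor.exists_mulVec_eq hT hq (h.norm_q_le hi) w
  let v : Fin 4 → ℤ_[p] := fun j =>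
    ⟨y j - S.U (i + j) w, (hy j).trans (PadicInt.norm_le_one _)⟩
  obtain ⟨w₁, hw₁⟩ := PadicInt.exists_smul_mulVec_eq (v := v) hy
  -- Both the old point, at `w₀`, and the perturbation, at `w₁`, lie in the lattice, so their sum is
  -- attained.
  obtain ⟨w', hw'⟩ := HasTaylor.exists_eq_mulVec hT hq (h.norm_q_le hi) (w₀ + w₁)
  refine ⟨w', fun j => ?_⟩
  have e : S.U (i + j) w' = S.U (i + j) w + v j := by
    rw [Matrix.mulVec_add, smul_add, ← add_assoc, ← hw₀, ← hw₁] at hw'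
    exact congrFun hw' j
  rw [e, PadicInt.coe_add]
  exact (add_sub_cancel _ _).symm

theorem exists_U_sub_eq (h : S.Expands u n) (hq : q ≠ 0) {i : ℕ} (hi : i + 3 ≤ n)
    (w : Fin 4 → ℤ_[p]) : ∃ w' : Fin 4 → ℤ_[p], ∀ j : Fin 4,
      (S.U (i + j) w : ℚ_[p]) - u (i + j) =
        (q : ℚ_[p]) * (somosD u i).mulVec (fun j => (w' j : ℚ_[p])) j := by
  have hT (j : Fin 4) : HasTaylor q (S.U (i + j)) (S.c (i + j)) (S.M i j) := S.taylor _
  obtain ⟨w', hw'⟩ := HasTaylor.exists_mulVec_eq hT hq (h.norm_q_le hi) w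
  refine ⟨w', fun j => ?_⟩
  have e := congrFun hw' j
  rw [← h.c_eq (i + j) (by omega), show S.U (i + j) w = _ from e, h.somosD_eq hi]
  simp only [Pi.add_apply, Pi.smul_apply, smul_eq_mul, PadicInt.coe_add, PadicInt.coe_mul,
    add_sub_cancel_left]
  congr 1

end Expands

end SomosExpansion

end Loop

/-! ### The loop invariant -/

section Main

variable {p : ℕ} [Fact p.Prime]

theorem Padic.valuation_nonneg_of_norm_le_one {x : ℚ_[p]} (hx : x ≠ 0) (h : ‖x‖ ≤ 1) :
    0 ≤ x.valuation := by
  rw [Padic.norm_eq_zpow_neg_valuation hx] at h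
  have hp : (1 : ℝ) < p := Nat.one_lt_cast.2 (Fact.out : p.Prime).one_lt
  rw [zpow_le_one_iff_right₀ hp] at h
  omega

/-- The working precision after `i` iterations of the loop. -/
noncomputable def somosPrec (m N : ℕ) (u : ℕ → ℚ_[p]) (i : ℕ) : ℤ :=
  N + ((u i).valuation + (u (i + 1)).valuation + (u (i + 2)).valuation + (u (i + 3)).valuation) +
    (2 - m) * ∑ j ∈ Finset.range i, (u j).valuation

namespace SomosExpansion.Expands

variable {N m n : ℕ} {x : Fin 4 → ℤ_[p]} {u : ℕ → ℚ_[p]}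
  {S : SomosExpansion ((p : ℤ_[p]) ^ N) x}

theorem valuation_det (h : S.Expands u n) {i : ℕ} (hi : i + 3 ≤ n) :
    (somosD u i).det.valuation = (u i).valuation + (u (i + 1)).valuation +
      (u (i + 2)).valuation + (u (i + 3)).valuation := by
  have h0 := h.isSomos.ne_zero i (by omega)
  have h1 := h.isSomos.ne_zero (i + 1) (by omega)
  have h2 := h.isSomos.ne_zero (i + 2) (by omega)
  have h3 := h.isSomos.ne_zero (i + 3) (by omega)
  rw [Padic.valuation_eq_of_norm_eq (by simp [*]) (h.norm_det_somosD hi),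
    Padic.valuation_mul (by simp [*]) h3, Padic.valuation_mul (by simp [*]) h2,
    Padic.valuation_mul h0 h1]

theorem valuation_nonneg (h : S.Expands u n) {k : ℕ} (hk : k ≤ n) : 0 ≤ (u k).valuation :=
  Padic.valuation_nonneg_of_norm_le_one (h.isSomos.ne_zero k hk) (h.norm_le_one hk)

/-- Equality holds for `m = 2`; smaller `m` only adds the nonnegative valuations of earlier terms to
the precision. -/
theorem zpow_neg_somosPrec_le (h : S.Expands u n) (hm : m ≤ 2) {i : ℕ} (hi : i + 3 ≤ n) :
    (p : ℝ) ^ (-somosPrec m N u i) ≤ ‖(p : ℤ_[p]) ^ N * (S.M i).det‖ := by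
  have hp : (1 : ℝ) < p := Nat.one_lt_cast.2 (Fact.out : p.Prime).one_lt
  have hdet : (somosD u i).det ≠ 0 := by
    have h0 := h.isSomos.ne_zero i (by omega)
    have h1 := h.isSomos.ne_zero (i + 1) (by omega)
    have h2 := h.isSomos.ne_zero (i + 2) (by omega)
    have h3 := h.isSomos.ne_zero (i + 3) (by omega)
    rw [← norm_ne_zero_iff, h.norm_det_somosD hi, norm_ne_zero_iff]
    simp [*]
  rw [norm_mul, PadicInt.norm_p_pow, PadicInt.norm_def, ← h.det_somosD_eq hi,
    Padic.norm_eq_zpow_neg_valuation hdet, ← zpow_add₀ (by positivity), h.valuation_det hi]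
  refine zpow_le_zpow_right₀ hp.le ?_
  have hs : 0 ≤ ∑ j ∈ Finset.range i, (u j).valuation :=
    Finset.sum_nonneg fun j hj => h.valuation_nonneg (by have := Finset.mem_range.1 hj; omega)
  have hm' : (0 : ℤ) ≤ 2 - m := by omega
  have := mul_nonneg hm' hs
  unfold somosPrec
  linarith

theorem zpow_neg_somosPrec_le_of_le (h : S.Expands u n) (hm : m ≤ 2) {i : ℕ} (hi : i + 3 ≤ n) :
    (p : ℝ) ^ (-somosPrec m N u i) ≤ ‖(p : ℤ_[p]) ^ N‖ * ‖u i‖ := by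
  refine (h.zpow_neg_somosPrec_le hm hi).trans ?_
  rw [norm_mul, h.norm_det hi, mul_assoc, mul_assoc]
  gcongr
  refine mul_le_of_le_one_right (norm_nonneg _) ?_
  exact mul_le_one₀ (h.norm_le_one (by omega)) (by positivity)
    (mul_le_one₀ (h.norm_le_one (by omega)) (by positivity) (h.norm_le_one (by omega)))

/-- The loop invariant: the variables are the values at a point near the initial terms. -/
structure Inv (_ : S.Expands u n) (m i : ℕ) (s : SomosState p) : Prop where
  prec : s.prec = somosPrec m N u i
  vec : ∃ w, ∀ j : Fin 4, s.vec j = S.U (i + j) w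

theorem inv_init (h : S.Expands u n) (hn : 3 ≤ n) {a b c d : ℚ_[p]}
    (ha : PadicCongr (N : ℤ) a (u 0)) (hb : PadicCongr (N : ℤ) b (u 1))
    (hc : PadicCongr (N : ℤ) c (u 2)) (hd : PadicCongr (N : ℤ) d (u 3)) :
    h.Inv m 0 ⟨a, b, c, d, N⟩ := by
  have hv (j : Fin 4) : (u j).valuation = 0 := by
    rw [Padic.valuation_eq_of_norm_eq one_ne_zero ((h.norm_init j).trans norm_one.symm),
      Padic.valuation_one]
  have v0 := hv 0
  have v1 := hv 1
  have v2 := hv 2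
  have v3 := hv 3
  refine ⟨?_, h.exists_U_eq ?_ (by omega) 0 ?_⟩
  · simp_all [somosPrec]
  · exact pow_ne_zero _ (Nat.cast_ne_zero.2 (Fact.out : p.Prime).ne_zero)
  · have hM : ‖(S.M 0).det‖ = 1 := by
      rw [h.norm_det (by omega)]
      have h0 := h.norm_init 0
      have h1 := h.norm_init 1
      have h2 := h.norm_init 2
      have h3 := h.norm_init 3
      simp_all
    intro j
    rw [norm_mul, hM, mul_one, PadicInt.norm_p_pow, (S.taylor _).1, zero_add,
      h.c_eq _ (by omega)]
    fin_cases j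
    exacts [padicCongr_iff.1 ha, padicCongr_iff.1 hb, padicCongr_iff.1 hc, padicCongr_iff.1 hd]

theorem Inv.exists_eq {h : S.Expands u n} {i : ℕ} {s : SomosState p} (hs : h.Inv m i s) :
    ∃ w, s.a = S.U i w ∧ s.b = S.U (i + 1) w ∧ s.c = S.U (i + 2) w ∧ s.d = S.U (i + 3) w := by
  obtain ⟨w, hw⟩ := hs.vec
  exact ⟨w, hw 0, hw 1, hw 2, hw 3⟩

theorem Inv.num_eq {h : S.Expands u n} {i : ℕ} {s : SomosState p} (hs : h.Inv m i s)
    (hi : i + 4 ≤ n) : ∃ w, s.a = S.U i w ∧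
      s.b * s.d + s.c ^ 2 = (S.U i w : ℚ_[p]) * S.U (i + 4) w := by
  obtain ⟨w, ha, hb, hc, hd⟩ := hs.exists_eq
  exact ⟨w, ha, by rw [hb, hc, hd]; exact ((h.isSomos_U w).rel i hi).symm⟩

/-- The quantities tested have norms `‖u i‖` and `‖u i‖ * ‖u (i + 4)‖`, while the precision is at
most `‖q‖ * ‖u i‖` in norm; nonvanishing of the terms modulo `q` decides both tests. -/
theorem Inv.exists_step {h : S.Expands u n} {i : ℕ} {s : SomosState p} (hs : h.Inv m i s)
    (hm : m ≤ 2) (hi : i + 4 ≤ n) : ∃ t, s.Step m t := by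
  have refl (k : ℤ) (y : ℚ_[p]) : PadicCongr k y y := ⟨0, by simp⟩
  have hle := h.zpow_neg_somosPrec_le_of_le hm (i := i) (by omega)
  obtain ⟨w, ha, hnum⟩ := hs.num_eq hi
  have hpos : 0 < ‖u i‖ := norm_pos_iff.2 (h.isSomos.ne_zero i (by omega))
  refine ⟨⟨s.b, s.c, s.d, (s.b * s.d + s.c ^ 2) / s.a,
    s.prec + (s.b * s.d + s.c ^ 2).valuation - (m : ℤ) * s.a.valuation⟩, ?_, ?_, rfl,
    s.a, s.b, s.c, s.d, ⟨refl _ _, refl _ _, refl _ _, refl _ _⟩,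
    refl _ _, refl _ _, refl _ _, refl _ _⟩
  · rw [padicCongr_iff, sub_zero, ha, h.norm_U (by omega), hs.prec, not_le]
    refine hle.trans_lt ((mul_le_of_le_one_right (norm_nonneg _) ?_).trans_lt
      (h.norm_lt i (by omega)))
    exact h.norm_le_one (by omega)
  · rw [padicCongr_iff, sub_zero, hnum, norm_mul, h.norm_U (by omega), h.norm_U hi, hs.prec,
      not_le, mul_comm]
    exact hle.trans_lt (mul_lt_mul_of_pos_right (h.norm_lt _ hi) hpos)

theorem Inv.step {h : S.Expands u n} {i : ℕ} {s t : SomosState p} (hs : h.Inv m i s)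
    (hm : m ≤ 2) (hi : i + 4 ≤ n) (hst : s.Step m t) : h.Inv m (i + 1) t := by
  have hq : (p : ℤ_[p]) ^ N ≠ 0 :=
    pow_ne_zero _ (Nat.cast_ne_zero.2 (Fact.out : p.Prime).ne_zero)
  obtain ⟨-, -, hprec, a', b', c', d', ⟨ha, hb, hc, hd⟩, hta, htb, htc, htd⟩ := hst
  have hprec' : t.prec = somosPrec m N u (i + 1) := by
    obtain ⟨w, hsa, hnum⟩ := hs.num_eq hi
    have v (k : ℕ) (hk : k ≤ n) : (S.U k w : ℚ_[p]).valuation = (u k).valuation :=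
      Padic.valuation_eq_of_norm_eq (h.isSomos.ne_zero k hk) (h.norm_U hk w)
    rw [hprec, hs.prec, hnum, hsa, Padic.valuation_mul ((h.isSomos_U w).ne_zero i (by omega))
      ((h.isSomos_U w).ne_zero (i + 4) hi), v i (by omega), v (i + 4) hi, somosPrec, somosPrec,
      Finset.sum_range_succ]
    ring
  refine ⟨hprec', ?_⟩
  obtain ⟨w, hw⟩ := hs.vec
  -- The lift moves to another exact sequence `U · w'`, whose next term is then the computed
  -- quotient with no error.
  obtain ⟨w', hw'⟩ : ∃ w', ∀ j : Fin 4, (![a', b', c', d'] : Fin 4 → ℚ_[p]) j =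
      S.U (i + j) w' := by
    refine h.exists_U_eq hq (by omega) w fun j => ?_
    refine le_trans ?_ (h.zpow_neg_somosPrec_le hm (by omega))
    rw [← hw, ← hs.prec]
    fin_cases j
    exacts [padicCongr_iff.1 ha, padicCongr_iff.1 hb, padicCongr_iff.1 hc, padicCongr_iff.1 hd]
  have e0 : a' = S.U i w' := hw' 0
  have e1 : b' = S.U (i + 1) w' := hw' 1
  have e2 : c' = S.U (i + 2) w' := hw' 2
  have e3 : d' = S.U (i + 3) w' := hw' 3
  have e4 : (b' * d' + c' ^ 2) / a' = S.U (i + 4) w' := by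
    rw [e0, e1, e2, e3, div_eq_iff ((h.isSomos_U w').ne_zero i (by omega))]
    exact ((h.isSomos_U w').rel i hi).symm.trans (mul_comm _ _)
  rw [e1] at hta
  rw [e2] at htb
  rw [e3] at htc
  rw [e4] at htd
  -- Truncation to the new precision is absorbed in the same way, now at index `i + 1`.
  refine h.exists_U_eq hq (by omega) w' fun j => ?_
  refine le_trans ?_ (h.zpow_neg_somosPrec_le hm (by omega))
  rw [← hprec', add_right_comm i 1]
  fin_cases j
  exacts [padicCongr_iff.1 hta, padicCongr_iff.1 htb, padicCongr_iff.1 htc, padicCongr_iff.1 htd]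

theorem inv_of_reach (h : S.Expands u n) (hm : m ≤ 2) (hn : 3 ≤ n) {a b c d : ℚ_[p]}
    (ha : PadicCongr (N : ℤ) a (u 0)) (hb : PadicCongr (N : ℤ) b (u 1))
    (hc : PadicCongr (N : ℤ) c (u 2)) (hd : PadicCongr (N : ℤ) d (u 3))
    {i : ℕ} (hi : i ≤ n - 3) {s : SomosState p} (hs : SomosReach m a b c d N i s) :
    h.Inv m i s := by
  induction hs with
  | init => exact h.inv_init hn ha hb hc hd
  | step _ hst ih => exact (ih (by omega)).step hm (by omega) hst

theorem exists_reach (h : S.Expands u n) (hm : m ≤ 2) (hn : 3 ≤ n) {a b c d : ℚ_[p]}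
    (ha : PadicCongr (N : ℤ) a (u 0)) (hb : PadicCongr (N : ℤ) b (u 1))
    (hc : PadicCongr (N : ℤ) c (u 2)) (hd : PadicCongr (N : ℤ) d (u 3))
    {i : ℕ} (hi : i ≤ n - 3) : ∃ s, SomosReach m a b c d N i s := by
  induction i with
  | zero => exact ⟨_, .init⟩
  | succ i ih =>
    obtain ⟨s, hs⟩ := ih (by omega)
    obtain ⟨t, ht⟩ := (h.inv_of_reach hm hn ha hb hc hd (by omega) hs).exists_step hm (by omega)
    exact ⟨t, hs.step ht⟩

end SomosExpansion.Expands

end Main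

/-! ### The main theorem -/

theorem exists_expands {p : ℕ} [Fact p.Prime] {n N : ℕ} (hn : 3 ≤ n) {u : ℕ → ℚ_[p]}
    (hu : ∀ k, k + 4 ≤ n → u (k + 4) = (u (k + 1) * u (k + 3) + u (k + 2) ^ 2) / u k)
    (hunit : ∀ k, k < 4 → ‖u k‖ = 1)
    (hdiv : ∀ k, k ≤ n → ¬ PadicCongr (N : ℤ) (u k) 0) :
    ∃ (x : Fin 4 → ℤ_[p]) (S : SomosExpansion ((p : ℤ_[p]) ^ N) x), S.Expands u n := by
  have hlt (k : ℕ) (hk : k ≤ n) : ‖(p : ℤ_[p]) ^ N‖ < ‖u k‖ := by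
    have := hdiv k hk
    rwa [padicCongr_iff, sub_zero, not_le, ← PadicInt.norm_p_pow] at this
  have h : IsSomos u n := by
    have hne (k : ℕ) (hk : k ≤ n) : u k ≠ 0 :=
      norm_pos_iff.1 ((norm_nonneg _).trans_lt (hlt k hk))
    refine ⟨fun k hk => ?_, hne⟩
    rw [hu k hk, mul_div_cancel₀ _ (hne k (by omega))]
  let x : Fin 4 → ℤ_[p] := fun j => ⟨u j, (hunit j j.2).le⟩
  obtain ⟨S⟩ := SomosExpansion.nonempty (q := (p : ℤ_[p]) ^ N) (x := x)
    ((hlt 0 (by omega)).trans_eq (hunit 0 (by omega))) fun j => hunit j j.2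
  exact ⟨x, S, h, fun j => hunit j j.2, S.c_eq h fun _ => rfl, hlt⟩

theorem mainTheorem4 (p : ℕ) [Fact p.Prime] (n N : ℕ) (hn : 3 ≤ n)
    -- the two forms of the precision update, see `SomosState.Step`
    (m : ℕ) (hm : m = 1 ∨ m = 2)
    -- the terms `u 0, ..., u n` of a SOMOS 4 sequence, the first four being `p`-adic units
    (u : ℕ → ℚ_[p])
    (hu : ∀ k, k + 4 ≤ n → u (k + 4) = (u (k + 1) * u (k + 3) + u (k + 2) ^ 2) / u k)
    (hunit : ∀ k, k < 4 → ‖u k‖ = 1)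
    -- none of them is divisible by `p ^ N`
    (hdiv : ∀ k, k ≤ n → ¬ PadicCongr (N : ℤ) (u k) 0)
    -- the input of the algorithm: approximations of the initial terms at precision `O(p ^ N)`
    (a b c d : ℚ_[p])
    (ha : PadicCongr (N : ℤ) a (u 0)) (hb : PadicCongr (N : ℤ) b (u 1))
    (hc : PadicCongr (N : ℤ) c (u 2)) (hd : PadicCongr (N : ℤ) d (u 3)) :
    -- all the terms are `p`-adic integers
    (∀ k, k ≤ n → ‖u k‖ ≤ 1) ∧
    -- no execution gets stuck before the end of the loop
    (∀ i, i < n - 3 → ∀ s, SomosReach m a b c d N i s → ∃ t, s.Step m t) ∧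
    -- the algorithm returns a value, and every value it may return is `u n` modulo `p ^ N`
    (∃ r, SomosReturns m a b c d n N r) ∧
    (∀ r, SomosReturns m a b c d n N r → PadicCongr (N : ℤ) r (u n)) ∧
    -- the loop invariants, with `φ_i` the differential of the `i`-th iterate of `f`
    (∀ i, i ≤ n - 3 →
      HasFDerivAt (𝕜 := ℚ_[p]) (somosMap^[i])
        (LinearMap.toContinuousLinearMap (Matrix.toLin' (somosD u i)))
        ![u 0, u 1, u 2, u 3] ∧
      ∀ s, SomosReach m a b c d N i s →
        (m = 2 → s.prec = (N : ℤ) + (somosD u i).det.valuation) ∧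
        (m = 1 → s.prec = (N : ℤ) + (somosD u i).det.valuation +
          ∑ j ∈ Finset.range i, (u j).valuation) ∧
        ∃ w : Fin 4 → ℤ_[p],
          s.vec - ![u i, u (i + 1), u (i + 2), u (i + 3)] =
            (p : ℚ_[p]) ^ N • (somosD u i).mulVec (fun j => (w j : ℚ_[p]))) := by
  have hm2 : m ≤ 2 := by omega
  obtain ⟨x, S, h⟩ := exists_expands hn hu hunit hdiv
  refine ⟨fun k hk => h.norm_le_one hk, fun i hi s hs => ?_, ?_, ?_, fun i hi => ⟨?_, ?_⟩⟩
  · exact (h.inv_of_reach hm2 hn ha hb hc hd hi.le hs).exists_step hm2 (by omega)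
  · obtain ⟨s, hs⟩ := h.exists_reach hm2 hn ha hb hc hd le_rfl
    exact ⟨s.d, s, hs, 0, by simp⟩
  · rintro r ⟨s, hs, hr⟩
    -- The final `d` is exactly `U n w`, which agrees with `u n` modulo `q = p ^ N`.
    obtain ⟨w, -, -, -, hw⟩ := (h.inv_of_reach hm2 hn ha hb hc hd le_rfl hs).exists_eq
    have hd' := h.norm_U_sub_le le_rfl w
    rw [PadicInt.norm_p_pow] at hd'
    rw [Nat.sub_add_cancel hn] at hw
    rw [padicCongr_iff] at hr ⊢
    rw [← sub_add_sub_cancel r s.d (u n)]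
    exact (Padic.nonarchimedean _ _).trans (max_le hr (by rwa [hw]))
  · exact h.isSomos.hasFDerivAt_iterate (by omega)
  · intro s hs
    have hs' := h.inv_of_reach hm2 hn ha hb hc hd hi hs
    refine ⟨fun e => ?_, fun e => ?_, ?_⟩
    · rw [hs'.prec, somosPrec, h.valuation_det (by omega), e]
      simp
    · rw [hs'.prec, somosPrec, h.valuation_det (by omega), e]
      norm_num
    · obtain ⟨w, hw⟩ := hs'.vec
      obtain ⟨w', hw'⟩ := h.exists_U_sub_eq
        (pow_ne_zero _ (Nat.cast_ne_zero.2 (Fact.out : p.Prime).ne_zero)) (by omega : i + 3 ≤ n) w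
      refine ⟨w', funext fun j => ?_⟩
      have e : ![u i, u (i + 1), u (i + 2), u (i + 3)] j = u (i + j) := by
        fin_cases j <;> rfl
      rw [Pi.sub_apply, e, hw, hw', Pi.smul_apply, smul_eq_mul]
      push_cast
      rfl
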